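/- **Setting.** Let $\mathcal V$ be a finite set of real time series indexed by $t\in\mathbb Z$, and let $\gamma_{max}\in\mathbb N$. A full-time causal graph, consistent throughout time, has arcs $X_{t-\gamma}\to Y_t$ ($0\le\gamma\le\gamma_{max}$, $\gamma>0$ if $X=Y$), the same for all $t$. Its summary graph $\mathcal G$ has $X\to Y$ iff $X_{t-\gamma}\to Y_t$ for some $\gamma$; $\mathcal G$ is assumed to be an acyclic summary causal graph with loops (ASCGL), i.e. without directed cycles other than loops. *Linear SCM.* $Y_t=\sum_{X,\gamma} a^{Y}_{X,\gamma}X_{t-\gamma}+\xi^Y_t$, where $a^Y_{X,\gamma}=0$ unless $X_{t-\gamma}\to Y_t$ is an arc; the noises $\xi^Y_t$ (over all $Y,t$) are jointly independent with positive variance, the series are square integrable, and each $Y_t$ is (a.s.) a function of the noises of its ancestors in the full-time graph (itself included). *Regimes and interventions.* The normal regime, with law $\mathcal N$, is a linear SCM with time-independent coefficients $a$. For each $Y$ there is a (possibly empty) set of times at which an external intervention on $Y$ is in force; at those times the coefficients of $Y$ are $\bar a^Y$ (zero outside the arcs of the full-time graph, so that no new lagged parent is created) and the noise law of $Y$ may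 be different; at all other times the coefficients and the noise law of $Y$ are the normal ones. The system under interventions, with law $\bar{\mathcal N}$, is again a linear SCM. An intervention on a vertex $Y$ that has a parent other than itself is parametric ($\bar a^Y\ne a^Y$, and the set of parents of $Y$ in $\mathcal G$ is unchanged) or structural (some parent of $Y$ in $\mathcal G$ is no longer one: all its coefficients in $\bar a^Y$ vanish). The anomalous regime consists of the times at which all interventions (on all intervened vertices) are in force. *Minimality condition.* For every arc $X_{t-\gamma}\to Y_t$ it is not the case that, under $\mathcal N$ and for all $t$, $Y_t$ is conditionally independent of $X_{t-\gamma}$ given the other parents of $Y_t$ in the full-time graph. *Anomalies.* A (collective) anomaly is present on $Y$ at time $t$ if the marginal laws of $Y$ under $\mathcal N$ and $\bar{\mathcal N}$ differ at $t$ and at $t+1$. $\mathcal A$ is the set of vertices on which an anomaly is present at some time; each $Y\in\mathcal A$ is assumed to have a first such time $\tau_Y$, its appearance time. An anomaly on $X$ propagates to $Z$ if there is a directed path $X=X^0\to\dots\to X^n=Z$ ($n\ge0$) of anomalous vertices with, for each $i$, an arc $X^i_{t-\gamma_i}\to X^{i+1}_t$ such that $\tau_{X^i}+\gamma_i\le\tau_{X^{i+1}}$.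 *Anomaly propagation assumption.* All anomalies are propagated from an external intervention through the SCM: (i) for every $Z\in\mathcal A$ there is a vertex $X$, subject to an external intervention, whose anomaly propagates to $Z$; (ii) for $X,Y\in\mathcal A$ and each arc $X_{t-\gamma}\to Y_t$, $\tau_Y\le\tau_X+\gamma$ (the lag is not smaller than the time between the two appearances). *Root causes.* $\mathcal C$ is the set of vertices that were affected by an external intervention and whose anomaly propagates to some vertex of $\mathcal A$ (possibly only to itself). **Algorithm EasyRCA.** Input: $\mathcal G$, $\gamma_{max}$, $\mathcal A$ with the appearance times, $\mathcal N$, $\bar{\mathcal N}$ (with a time $t$ of the normal and a time $t'$ of the anomalous regime). 1. Take any list $\mathcal L^1,\dots,\mathcal L^m$ of linked anomalous graphs covering $\mathcal A$: each $\mathcal L^i$ is the subgraph of $\mathcal G$ induced by some $\mathcal A^i\subseteq\mathcal A$ that is d-separated in $\mathcal G$ from $\mathcal A\setminus\mathcal A^i$ by some $\mathcal S\subseteq\mathcal V\setminus\mathcal A$. (d-separation is defined through paths with distinct vertices, so that loops play no role as edges of a path.) 2. For each $i$ let $\mathcal R^i$ be the set of sub-root vertices ($Y\in\mathcal A^i$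 without a parent other than $Y$ in $\mathcal A^i$) and $\mathcal T^i$ the set of time-defying vertices ($Y\in\mathcal A^i$ with $\tau_Y<\tau_X$ for all parents $X\neq Y$ of $Y$ in $\mathcal A^i$). 3. For $Y\in\mathcal A^i\setminus(\mathcal R^i\cup\mathcal T^i)$, for $X$ a parent of $Y$ in $\mathcal G$ and for each integer lag $\gamma$ with $\max(0,\bar\gamma_{XY})\le\gamma\le\gamma_{max}$ ($\gamma>0$ if $X=Y$), where $\bar\gamma_{XY}=\tau_Y-\tau_X$ if $X\in\mathcal A$ and $\bar\gamma_{XY}=0$ otherwise, compute the direct effect $DE_{X_{t-\gamma}\to Y_t}$ in each regime as the coefficient of $X_{t-\gamma}$ in the population linear regression of $Y_t$ on $X_{t-\gamma}$ and the adjustment set $\{Z_{t-k}: Z\in Parents(Y,\mathcal G)\setminus\{X,Y\},\,0\le k\le\gamma_{max}\}\cup\{X_{t-k}:0\le k\le\gamma_{max},\,k\ne\gamma\}\cup\mathcal Y$, with $\mathcal Y=\{Y_{t-1},\dots,Y_{t-\gamma_{max}}\}$ if $Y$ has a loop and $\mathcal Y=\emptyset$ otherwise (for $X=Y$, $Y_t$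 and $X_{t-\gamma}$ are removed from the adjustment set). Let $\mathcal D^i$ be the set of those $Y$ for which $DE^{N}\ne0$ and $DE^{N}\ne DE^{\bar N}$ for some such $X$, $\gamma$. 4. Return $\mathcal R=\bigcup_i\mathcal R^i$, $\mathcal T=\bigcup_i\mathcal T^i$, $\mathcal D=\bigcup_i\mathcal D^i$. **Theorem.** In this setting, under the anomaly propagation assumption and the minimality condition, for every list of linked anomalous graphs covering $\mathcal A$, every time $t$ of the normal regime and every time $t'$ of the anomalous regime, EasyRCA identifies the set of root causes: $$\mathcal R\cup\mathcal T\cup\mathcal D=\mathcal C .$$ -/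

import Mathlib

open MeasureTheory ProbabilityTheory

namespace EasyRCA

/-! ### Causal graphs of dynamic systems -/

/-- A summary causal graph `G` on the time series `V` (`G X Y` means `X → Y`) is an acyclic summary
causal graph with loops if it has no directed cycle other than loops `X → X`. -/
def IsASCGL {V : Type*} (G : V → V → Prop) : Prop :=
  ∀ X : V, ¬ Relation.TransGen (fun A B : V => A ≠ B ∧ G A B) X X

/-- A full-time causal graph that is consistent throughout time, given by its window:
`edge X Y γ` means that `X_{t-γ} → Y_t` for every time `t`. -/
structure WindowGraph (V : Type*) (γmax : ℕ) where
  edge : V → V → ℕ → Prop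
  lag_le : ∀ X Y γ, edge X Y γ → γ ≤ γmax
  no_self : ∀ X, ¬ edge X X 0

/-- `G` is the summary causal graph of the window graph `W`. -/
def WindowGraph.HasSummary {V : Type*} {γmax : ℕ} (W : WindowGraph V γmax)
    (G : V → V → Prop) : Prop :=
  ∀ X Y, G X Y ↔ ∃ γ, W.edge X Y γ

/-- Arcs of the full-time graph; the vertex `(X, t)` stands for `X_t`. -/
def WindowGraph.FullArc {V : Type*} {γmax : ℕ} (W : WindowGraph V γmax) (i j : V × ℤ) : Prop :=
  ∃ γ : ℕ, W.edge i.1 j.1 γ ∧ i.2 + (γ : ℤ) = j.2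

/-- Ancestors of a vertex in the full-time graph, the vertex itself included. -/
def WindowGraph.ancestors {V : Type*} {γmax : ℕ} (W : WindowGraph V γmax) (i : V × ℤ) :
    Set (V × ℤ) :=
  {j | Relation.ReflTransGen W.FullArc j i}

/-! ### d-separation -/

/-- The consecutive vertices `A, M, B` of a path block it given `Z`: either `M` is a collider
`A → M ← B` without descendants in `Z` (`M` counts as its own descendant), or `M` is the middle of
a chain or a fork and `M ∈ Z`. -/
def BlockedTriple {V : Type*} (G : V → V → Prop) (Z : Set V) (A M B : V) : Prop :=
  ((G A M ∧ G B M) ∧ ∀ D ∈ Z, ¬ Relation.ReflTransGen G M D) ∨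
    (¬ (G A M ∧ G B M) ∧ M ∈ Z)

/-- A path of `G`: distinct vertices, consecutive ones being adjacent. Loops never occur in it. -/
def IsPath {V : Type*} (G : V → V → Prop) (p : List V) : Prop :=
  p.Nodup ∧ p.IsChain (fun A B => G A B ∨ G B A)

/-- The path `p` is blocked by `Z`. -/
def Blocked {V : Type*} (G : V → V → Prop) (Z : Set V) (p : List V) : Prop :=
  ∃ A M B : V, [A, M, B] <:+: p ∧ BlockedTriple G Z A M B

/-- `X` and `Y` are d-separated by `Z`: every path from `X` to `Y` is blocked by `Z`. -/
def DSep {V : Type*} (G : V → V → Prop) (X Y Z : Set V) : Prop :=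
  ∀ p : List V, IsPath G p → (∃ x ∈ X, p.head? = some x) → (∃ y ∈ Y, p.getLast? = some y) →
    Blocked G Z p

/-! ### Linear structural causal models, through the law of the time series -/

/-- Trajectories of the family of time series; `ω Y t` is the value of `Y_t`. -/
abbrev Path (V : Type*) := V → ℤ → ℝ

/-- The noise at `(Y, t)` of a linear model with coefficients `c`: the coefficient of `X_{t-γ}` in
the equation of `Y_t` is `c Y t X γ`, so that
`Y_t = ∑_{X, γ} c Y t X γ * X_{t-γ} + noise`. -/
noncomputable def noise {V : Type*} [Fintype V] (γmax : ℕ) (c : V → ℤ → V → ℕ → ℝ) (i : V × ℤ)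
    (ω : Path V) : ℝ :=
  ω i.1 i.2 - ∑ X : V, ∑ γ ∈ Finset.range (γmax + 1), c i.1 i.2 X γ * ω X (i.2 - (γ : ℤ))

/-- `P` is the law of a family of time series generated by a linear structural causal model on the
full-time graph of `W` with (possibly time-dependent) coefficients `c` and jointly independent,
nondegenerate noises; each `Y_t` is a function of the noises of its ancestors. -/
structure IsLinearSCM {V : Type*} [Fintype V] {γmax : ℕ} (W : WindowGraph V γmax)
    (c : V → ℤ → V → ℕ → ℝ) (P : Measure (Path V)) : Prop where
  support : ∀ Y t X γ, c Y t X γ ≠ 0 → W.edge X Y γ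
  square_integrable : ∀ Y t, MemLp (fun ω : Path V => ω Y t) 2 P
  noise_indep : iIndepFun (fun (i : V × ℤ) (ω : Path V) => noise γmax c i ω) P
  noise_nondegenerate : ∀ i : V × ℤ, 0 < variance (noise γmax c i) P
  causal : ∀ i : V × ℤ, ∃ g : Path V → ℝ,
    Measurable[⨆ j ∈ W.ancestors i, MeasurableSpace.comap (noise γmax c j) inferInstance] g ∧
      (fun ω : Path V => ω i.1 i.2) =ᵐ[P] g

/-- The values at time `t` of the lagged vertices in `S`; `(Z, k)` stands for `Z_{t-k}`. -/
def lagged {V : Type*} (S : Set (V × ℕ)) (t : ℤ) (ω : Path V) : S → ℝ :=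
  fun r => ω r.1.1 (t - (r.1.2 : ℤ))

theorem measurable_lagged {V : Type*} (S : Set (V × ℕ)) (t : ℤ) :
    Measurable (lagged S t) := by
  unfold lagged
  fun_prop

/-- The minimality condition for the law `P`: no arc `X_{t-γ} → Y_t` is superfluous, i.e. it is not
the case that, at all times `t`, `Y_t` is independent of `X_{t-γ}` given the other parents of
`Y_t`. -/
def Minimality {V : Type*} [Fintype V] {γmax : ℕ} (W : WindowGraph V γmax)
    (P : Measure (Path V)) [IsFiniteMeasure P] : Prop :=
  ∀ X Y γ, W.edge X Y γ → ∃ t : ℤ,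
    ¬ CondIndepFun
      (MeasurableSpace.comap (lagged {r : V × ℕ | W.edge r.1 Y r.2 ∧ r ≠ (X, γ)} t) inferInstance)
      (measurable_lagged _ t).comap_le
      (fun ω : Path V => ω Y t) (fun ω : Path V => ω X (t - (γ : ℤ))) P

/-! ### Interventions, anomalies, root causes -/

/-- The intervention that replaces the coefficients `a Y` of the mechanism of `Y` by `a' Y` is
parametric: the mechanism changes, the parents of `Y` do not. -/
def IsParametric {V : Type*} (G : V → V → Prop) (a a' : V → V → ℕ → ℝ) (Y : V) : Prop :=
  a' Y ≠ a Y ∧ ∀ X, (∃ γ, a' Y X γ ≠ 0) ↔ G X Y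

/-- The intervention that changes the coefficients of `Y` into `a' Y` is structural: some parent
of `Y` is no longer a parent of `Y`. -/
def IsStructural {V : Type*} (G : V → V → Prop) (a' : V → V → ℕ → ℝ) (Y : V) : Prop :=
  ∃ X, G X Y ∧ ∀ γ, a' Y X γ = 0

open Classical in
/-- Coefficients of the system under interventions: `active Y` is the set of the times at which an
external intervention on `Y` is in force (empty if there is none). -/
noncomputable def regimeCoef {V : Type*} (a a' : V → V → ℕ → ℝ) (active : V → Set ℤ) :
    V → ℤ → V → ℕ → ℝ :=
  fun Y t => if t ∈ active Y then a' Y else a Y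

/-- The times of the anomalous regime: all the interventions are in force. -/
def anomalousRegime {V : Type*} (active : V → Set ℤ) : Set ℤ :=
  {t | ∀ Y, (active Y).Nonempty → t ∈ active Y}

/-- The system with coefficients `a` and law `P` (the normal regime) turns into the system with law
`P'` through external interventions. While no intervention on `Y` is in force, its mechanism and
the law of its noise are the normal ones; an intervention changes the coefficients of `Y` to `a' Y`
and may change the law of its noise. An intervention on a vertex with a parent other than itself is
parametric or structural. -/
structure IsIntervenedSystem {V : Type*} [Fintype V] {γmax : ℕ} (W : WindowGraph V γmax)
    (G : V → V → Prop) (a a' : V → V → ℕ → ℝ) (active : V → Set ℤ)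
    (P P' : Measure (Path V)) : Prop where
  normal : IsLinearSCM W (fun Y _ => a Y) P
  intervened : IsLinearSCM W (regimeCoef a a' active) P'
  noise_law : ∀ Y t, t ∉ active Y →
    P'.map (noise γmax (regimeCoef a a' active) (Y, t)) =
      P.map (noise γmax (fun Y _ => a Y) (Y, t))
  kind : ∀ Y, (active Y).Nonempty → (∃ X, X ≠ Y ∧ G X Y) →
    IsParametric G a a' Y ∨ IsStructural G a' Y

/-- The marginal law of `Y_t`. -/
noncomputable def marginal {V : Type*} (P : Measure (Path V)) (Y : V) (t : ℤ) : Measure ℝ :=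
  P.map (fun ω : Path V => ω Y t)

/-- At time `t` a collective anomaly is present on `Y` (not just a point anomaly): the marginal law
of `Y` differs from the normal one at `t` and at the next instant. -/
def AnomalyAt {V : Type*} (P P' : Measure (Path V)) (Y : V) (t : ℤ) : Prop :=
  marginal P' Y t ≠ marginal P Y t ∧ marginal P' Y (t + 1) ≠ marginal P Y (t + 1)

/-- The set of anomalous vertices. -/
def anomalousVertices {V : Type*} (P P' : Measure (Path V)) : Set V :=
  {Y | ∃ t, AnomalyAt P P' Y t}

/-- The anomaly on `X` propagates to `Y` along arcs of the full-time graph through anomalous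
vertices, where `τ` is the appearance time of the anomalies: an anomaly that is propagated along
`X_{t-γ} → Y_t` appears on `Y` at least `γ` instants after it appeared on `X`. -/
inductive PropagatedFrom {V : Type*} {γmax : ℕ} (W : WindowGraph V γmax) (A : Set V)
    (τ : V → ℤ) (X : V) : V → Prop
  | refl : X ∈ A → PropagatedFrom W A τ X X
  | step {Y Z : V} {γ : ℕ} : PropagatedFrom W A τ X Y → Z ∈ A → W.edge Y Z γ →
      τ Y + (γ : ℤ) ≤ τ Z → PropagatedFrom W A τ X Z

/-- Anomalies are propagated from external interventions through the structural causal model. -/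
structure AnomalyPropagation {V : Type*} {γmax : ℕ} (W : WindowGraph V γmax) (A : Set V)
    (τ : V → ℤ) (active : V → Set ℤ) : Prop where
  /-- Every anomaly is propagated from an external intervention. -/
  origin : ∀ Y ∈ A, ∃ X, (active X).Nonempty ∧ PropagatedFrom W A τ X Y
  /-- For anomalous `X` and `Y`, the lags of the causal relation of `X` to `Y` are not smaller than
  the time between the appearances of the anomalies on `X` and on `Y`: the anomaly on `X` reaches
  `Y` along each arc. -/
  lag : ∀ X ∈ A, ∀ Y ∈ A, ∀ γ : ℕ, W.edge X Y γ → τ Y ≤ τ X + (γ : ℤ)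

/-- The root causes: the vertices affected by an external intervention that led to an anomaly. -/
def rootCauses {V : Type*} {γmax : ℕ} (W : WindowGraph V γmax) (A : Set V) (τ : V → ℤ)
    (active : V → Set ℤ) : Set V :=
  {X | (active X).Nonempty ∧ ∃ Y ∈ A, PropagatedFrom W A τ X Y}

/-! ### The algorithm

Its input: the graph `G`, the maximal lag, the anomalous vertices `A` with the appearance times `τ`
of the anomalies, and the laws of the time series in both regimes. -/

/-- `L` lists the vertex sets of the linked anomalous graphs (which are induced subgraphs of `G`):
the sets cover `A`, and each of them is d-separated from the other anomalous vertices by a set of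
normal vertices. -/
structure IsLinkedAnomalousList {V : Type*} (G : V → V → Prop) (A : Set V) (L : List (Set V)) :
    Prop where
  subset : ∀ B ∈ L, B ⊆ A
  cover : ∀ Y ∈ A, ∃ B ∈ L, Y ∈ B
  dsep : ∀ B ∈ L, ∃ S : Set V, S ⊆ Aᶜ ∧ DSep G B (A \ B) S

/-- Sub-root vertices of the linked anomalous graph on `B`: no parent in `B`, loops aside. -/
def subRoots {V : Type*} (G : V → V → Prop) (B : Set V) : Set V :=
  {Y ∈ B | ∀ X ∈ B, X ≠ Y → ¬ G X Y}

/-- Time defying vertices of the linked anomalous graph on `B`: the anomaly on `Y` precedes the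
anomaly on each parent of `Y` in `B`, loops aside. -/
def timeDefying {V : Type*} (G : V → V → Prop) (τ : V → ℤ) (B : Set V) : Set V :=
  {Y ∈ B | ∀ X ∈ B, X ≠ Y → G X Y → τ Y < τ X}

open Classical in
/-- The adjustment set for the direct effect of `X_{t-γ}` on `Y_t`; `(Z, k)` stands for `Z_{t-k}`.
Taking away `X_{t-γ}` and `Y_t` at the end only matters for a loop, `X = Y`. -/
noncomputable def adjustmentSet {V : Type*} [Fintype V] (G : V → V → Prop) (γmax : ℕ) (X Y : V)
    (γ : ℕ) : Finset (V × ℕ) :=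
  ((Finset.univ.filter (fun Z => G Z Y ∧ Z ≠ X ∧ Z ≠ Y)) ×ˢ Finset.range (γmax + 1) ∪
    {X} ×ˢ (Finset.range (γmax + 1)).erase γ ∪
    (if G Y Y then {Y} ×ˢ Finset.Icc 1 γmax else ∅)) \ {(X, γ), (Y, 0)}

open Classical in
/-- The direct effect of `X_{t-γ}` on `Y_t` as computed from the law `P`: the coefficient of
`X_{t-γ}` in the linear regression of `Y_t` on `X_{t-γ}` and the adjustment set. The vector of
regression coefficients is `Cov(R, R)⁻¹ Cov(R, Y_t)`. -/
noncomputable def directEffect {V : Type*} [Fintype V] (G : V → V → Prop) (γmax : ℕ)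
    (P : Measure (Path V)) (t : ℤ) (X Y : V) (γ : ℕ) : ℝ :=
  let R : Finset (V × ℕ) := insert (X, γ) (adjustmentSet G γmax X Y γ)
  let val : R → Path V → ℝ := fun r ω => ω r.1.1 (t - (r.1.2 : ℤ))
  let M : Matrix R R ℝ := Matrix.of fun r s => covariance (val r) (val s) P
  let v : R → ℝ := fun r => covariance (val r) (fun ω => ω Y t) P
  (M⁻¹.mulVec v) ⟨(X, γ), Finset.mem_insert_self _ _⟩

open Classical in
/-- The anomaly lag between `X` and `Y`, taken to be `0` if there is no anomaly on `X`. -/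
noncomputable def anomalyLag {V : Type*} (A : Set V) (τ : V → ℤ) (X Y : V) : ℤ :=
  if X ∈ A then τ Y - τ X else 0

/-- The lags of `X → Y` that are examined: from the anomaly lag to the maximal lag, among the lags
that are possible for the arc `X → Y` (nonnegative, and positive for a loop). -/
def candidateLags {V : Type*} (γmax : ℕ) (A : Set V) (τ : V → ℤ) (X Y : V) : Set ℕ :=
  {γ | anomalyLag A τ X Y ≤ (γ : ℤ) ∧ γ ≤ γmax ∧ (X = Y → 0 < γ)}

/-- The vertices of the linked anomalous graph on `B` that are found by comparing the direct
effects in the normal regime (law `P`, time `t`) and in the anomalous regime (law `P'`, time `t'`). -/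
def changedEffect {V : Type*} [Fintype V] (G : V → V → Prop) (γmax : ℕ) (A : Set V) (τ : V → ℤ)
    (P P' : Measure (Path V)) (t t' : ℤ) (B : Set V) : Set V :=
  {Y ∈ B \ (subRoots G B ∪ timeDefying G τ B) |
    ∃ X, G X Y ∧ ∃ γ ∈ candidateLags γmax A τ X Y,
      directEffect G γmax P t X Y γ ≠ 0 ∧
      directEffect G γmax P t X Y γ ≠ directEffect G γmax P' t' X Y γ}

/-- The three sets returned by the algorithm. -/
structure Output (V : Type*) where
  R : Set V
  T : Set V
  D : Set V

/-- Algorithm EasyRCA, run on the list `L` of linked anomalous graphs. -/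
def easyRCA {V : Type*} [Fintype V] (G : V → V → Prop) (γmax : ℕ) (A : Set V) (τ : V → ℤ)
    (P P' : Measure (Path V)) (t t' : ℤ) (L : List (Set V)) : Output V where
  R := ⋃ B ∈ L, subRoots G B
  T := ⋃ B ∈ L, timeDefying G τ B
  D := ⋃ B ∈ L, changedEffect G γmax A τ P P' t t' B

end EasyRCA

/-!
The output of the algorithm is matched with the root causes through two facts.

*Combinatorial.* A path with two vertices has no inner vertex, so nothing blocks it; hence adjacent
anomalous vertices lie in the same linked anomalous graph. If the anomaly on `Y` comes from another
vertex, its last step other than a loop gives an anomalous parent `Z ≠ Y` with `τ Z ≤ τ Y`, and `Z`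
lies in the linked graph of `Y`. So sub-root and time-defying vertices are intervened
(`mem_rootCauses_of_no_earlier_parent`).

*Probabilistic.* The full-time graph is acyclic, so the noise of `Y_t` is independent of every
family of non-descendants of `Y_t` (`IsLinearSCM.indepFun_noise`). The covariance matrix of
finitely many distinct variables is nonsingular, because the noise of a topologically last one
enters no other (`IsLinearSCM.det_covariance_ne_zero`). The regressors of a direct effect are
non-descendants of `Y_t` that include all its parents, so the normal equations have the structural
coefficients as their unique solution (`IsLinearSCM.directEffect_eq`). Moreover, a vanishing
coefficient on an arc would make `Y_t` conditionally independent of `X_{t-γ}` given the other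
parents, so minimality makes the normal coefficients nonzero on all arcs
(`IsLinearSCM.coef_ne_zero`).

Consequently a direct effect that changes reveals an intervention. Conversely, a parametric or
structural intervention changes the coefficient of an arc, which is nonzero in the normal regime,
and the lag of this arc is examined because the lag of an arc between anomalous vertices is at
least the time between the two appearances.
-/

open MeasureTheory ProbabilityTheory

namespace EasyRCA

/-! ### Acyclicity of the full-time graph -/

/-- Along a directed path of the full-time graph time does not decrease, and a path within one
instant is a loop-free path of the summary graph. -/
theorem WindowGraph.transGen_fullArc {V : Type*} {γmax : ℕ} {W : WindowGraph V γmax}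
    {G : V → V → Prop} (hW : W.HasSummary G) {i j : V × ℤ}
    (h : Relation.TransGen W.FullArc i j) :
    i.2 ≤ j.2 ∧ (i.2 = j.2 → Relation.TransGen (fun A B : V => A ≠ B ∧ G A B) i.1 j.1) := by
  have key : ∀ {i j : V × ℤ}, W.FullArc i j →
      i.2 ≤ j.2 ∧ (i.2 = j.2 → i.1 ≠ j.1 ∧ G i.1 j.1) := by
    rintro i j ⟨γ, he, ht⟩
    refine ⟨by omega, fun h => ⟨fun hne => ?_, (hW _ _).2 ⟨γ, he⟩⟩⟩
    have : γ = 0 := by omega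
    subst this
    rw [hne] at he
    exact W.no_self _ he
  induction h with
  | single h => exact ⟨(key h).1, fun e => .single ((key h).2 e)⟩
  | tail _ h ih =>
    have := key h
    exact ⟨ih.1.trans this.1, fun e => (ih.2 (by omega)).tail (this.2 (by omega))⟩

theorem WindowGraph.not_transGen_fullArc_self {V : Type*} {γmax : ℕ} {W : WindowGraph V γmax}
    {G : V → V → Prop} (hG : IsASCGL G) (hW : W.HasSummary G) (i : V × ℤ) :
    ¬ Relation.TransGen W.FullArc i i :=
  fun h => hG _ ((transGen_fullArc hW h).2 rfl)

theorem WindowGraph.notMem_ancestors_of_fullArc {V : Type*} {γmax : ℕ} {W : WindowGraph V γmax}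
    {G : V → V → Prop} (hG : IsASCGL G) (hW : W.HasSummary G) {i j : V × ℤ}
    (h : W.FullArc j i) : i ∉ W.ancestors j :=
  fun hij => not_transGen_fullArc_self hG hW i (Relation.TransGen.tail' hij h)

/-- `Y_t` is not an ancestor of an earlier or simultaneous value of a parent of `Y`. -/
theorem WindowGraph.notMem_ancestors_of_parent {V : Type*} {γmax : ℕ} {W : WindowGraph V γmax}
    {G : V → V → Prop} (hG : IsASCGL G) (hW : W.HasSummary G) {Y Z : V} {k : ℕ}
    (hZ : G Z Y) (hne : (Z, k) ≠ (Y, 0)) (t : ℤ) : (Y, t) ∉ W.ancestors (Z, t - (k : ℤ)) := by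
  intro h
  rcases Relation.reflTransGen_iff_eq_or_transGen.1 h with h | h
  · simp only [Prod.mk.injEq] at h
    exact hne (by ext <;> simp <;> [exact h.1; omega])
  · have h' := transGen_fullArc hW h
    simp only at h'
    have hYZ := h'.2 (by omega)
    by_cases e : Z = Y
    · subst e
      exact hG _ hYZ
    · exact hG _ (hYZ.tail ⟨e, hZ⟩)

/-- Every nonempty finite set of vertices has a topologically last element: one that is an ancestor
of no other. -/
theorem WindowGraph.exists_last {V : Type*} {γmax : ℕ} {W : WindowGraph V γmax}
    {G : V → V → Prop} (hG : IsASCGL G) (hW : W.HasSummary G) {ι : Type*} (s : Finset ι)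
    (hs : s.Nonempty) (f : ι → V × ℤ) (hf : Function.Injective f) :
    ∃ i ∈ s, ∀ j ∈ s, j ≠ i → f i ∉ W.ancestors (f j) := by
  -- A maximal element for the ancestor preorder is last because there are no directed cycles.
  let _ : Preorder ι :=
    { le := fun i j => Relation.ReflTransGen W.FullArc (f i) (f j)
      le_refl := fun _ => .refl
      le_trans := fun _ _ _ => .trans }
  obtain ⟨i, hi, hmax⟩ := s.exists_maximal hs
  refine ⟨i, hi, fun j hj hne hij => ?_⟩
  rcases Relation.reflTransGen_iff_eq_or_transGen.1 hij with h | h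
  · exact hne (hf h)
  · exact not_transGen_fullArc_self hG hW (f i) (h.trans_left (hmax hj hij))

/-! ### Independence of a noise and the non-descendants -/

section SCM

variable {V : Type*} [Fintype V] {γmax : ℕ}

theorem measurable_noise (c : V → ℤ → V → ℕ → ℝ) (i : V × ℤ) :
    Measurable (noise γmax c i) := by
  unfold noise
  fun_prop

variable {W : WindowGraph V γmax} {c : V → ℤ → V → ℕ → ℝ} {P : Measure (Path V)}

/-- A noise is independent of the joint value of any family of non-descendants, as these are
functions of the other noises. -/
theorem IsLinearSCM.indepFun_noise (h : IsLinearSCM W c P) {ι : Type*} [Countable ι]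
    (f : ι → V × ℤ) (i : V × ℤ) (hf : ∀ r, i ∉ W.ancestors (f r)) :
    IndepFun (fun (ω : Path V) (r : ι) => ω (f r).1 (f r).2) (noise γmax c i) P := by
  choose g hg hae using h.causal
  have hind := indep_iSup_of_disjoint (fun j => (measurable_noise c j).comap_le)
    h.noise_indep (S := {i}ᶜ) (T := {i}) (by simp)
  rw [iSup_singleton] at hind
  have hg' : Measurable[⨆ j ∈ ({i}ᶜ : Set (V × ℤ)),
      MeasurableSpace.comap (noise γmax c j) inferInstance]
      (fun (ω : Path V) (r : ι) => g (f r) ω) := by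
    refine @measurable_pi_lambda _ _ _ (_) _ _ fun r => (hg (f r)).mono ?_ le_rfl
    exact biSup_mono fun j hj hji => hf r (hji ▸ hj)
  have : IndepFun (fun (ω : Path V) (r : ι) => g (f r) ω) (noise γmax c i) P :=
    (IndepFun_iff_Indep _ _ _).2 (indep_of_indep_of_le_left hind hg'.comap_le)
  refine this.congr ?_ .rfl
  filter_upwards [ae_all_iff.2 fun r => hae (f r)] with ω hω
  exact funext fun r => (hω r).symm

theorem IsLinearSCM.memLp_noise (h : IsLinearSCM W c P) (i : V × ℤ) :
    MemLp (noise γmax c i) 2 P := by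
  unfold noise
  refine (h.square_integrable _ _).sub (memLp_finsetSum _ fun X _ => memLp_finsetSum _ fun γ _ =>
    (h.square_integrable _ _).const_mul _)

theorem IsLinearSCM.covariance_noise (h : IsLinearSCM W c P) {i j : V × ℤ}
    (hij : i ∉ W.ancestors j) : cov[fun ω : Path V => ω j.1 j.2, noise γmax c i; P] = 0 := by
  have := (h.indepFun_noise (fun _ : Unit => j) i fun _ => hij).comp
    (measurable_pi_apply ()) measurable_id
  exact this.covariance_eq_zero (h.square_integrable _ _) (h.memLp_noise i)

theorem eq_sum_add_noise (c : V → ℤ → V → ℕ → ℝ) (Y : V) (t : ℤ) :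
    (fun ω : Path V => ω Y t) = fun ω => (∑ r ∈ Finset.univ ×ˢ Finset.range (γmax + 1),
      c Y t r.1 r.2 * ω r.1 (t - (r.2 : ℤ))) + noise γmax c (Y, t) ω := by
  ext ω
  simp [noise, Finset.sum_product]

variable [IsProbabilityMeasure P]

theorem IsLinearSCM.covariance_eq (h : IsLinearSCM W c P) {X : Path V → ℝ} (hX : MemLp X 2 P)
    (Y : V) (t : ℤ) :
    cov[X, fun ω : Path V => ω Y t; P] = (∑ r ∈ Finset.univ ×ˢ Finset.range (γmax + 1),
      c Y t r.1 r.2 * cov[X, fun ω : Path V => ω r.1 (t - (r.2 : ℤ)); P]) +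
        cov[X, noise γmax c (Y, t); P] := by
  have hm : ∀ r ∈ (Finset.univ ×ˢ Finset.range (γmax + 1) : Finset (V × ℕ)),
      MemLp (fun ω : Path V => c Y t r.1 r.2 * ω r.1 (t - (r.2 : ℤ))) 2 P :=
    fun r _ => (h.square_integrable _ _).const_mul _
  rw [eq_sum_add_noise (γmax := γmax) c Y t]
  have := covariance_add_right hX (memLp_finsetSum _ hm) (h.memLp_noise (Y, t))
  refine this.trans ?_
  rw [covariance_fun_sum_right' hm hX]
  simp only [covariance_const_mul_right]

variable {G : V → V → Prop}

theorem IsLinearSCM.covariance_self_noise (h : IsLinearSCM W c P) (hG : IsASCGL G)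
    (hW : W.HasSummary G) (i : V × ℤ) :
    cov[fun ω : Path V => ω i.1 i.2, noise γmax c i; P] = Var[noise γmax c i; P] := by
  rw [covariance_comm, h.covariance_eq (h.memLp_noise i),
    covariance_self (measurable_noise c i).aemeasurable, add_eq_right]
  refine Finset.sum_eq_zero fun r _ => ?_
  by_cases hc : c i.1 i.2 r.1 r.2 = 0
  · simp [hc]
  · rw [covariance_comm, h.covariance_noise (j := (r.1, i.2 - (r.2 : ℤ))), mul_zero]
    exact W.notMem_ancestors_of_fullArc hG hW ⟨r.2, h.support _ _ _ _ hc, by simp⟩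

/-! ### Regression coefficients -/

/-- A linear dependence would involve the noise of the topologically last vertex with a nonzero
coefficient; this noise is uncorrelated with the other vertices. -/
theorem IsLinearSCM.det_covariance_ne_zero (h : IsLinearSCM W c P) (hG : IsASCGL G)
    (hW : W.HasSummary G) {ι : Type*} [Fintype ι] [DecidableEq ι] (f : ι → V × ℤ)
    (hf : Function.Injective f) :
    (Matrix.of fun r s : ι => cov[fun ω : Path V => ω (f r).1 (f r).2,
      fun ω : Path V => ω (f s).1 (f s).2; P]).det ≠ 0 := by
  intro hdet
  obtain ⟨b, hb, hMb⟩ := Matrix.exists_mulVec_eq_zero_iff.2 hdet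
  obtain ⟨i₀, hi₀⟩ := Function.ne_iff.1 hb
  obtain ⟨i, hi, hlast⟩ := W.exists_last hG hW (Finset.univ.filter fun i => b i ≠ 0)
    ⟨i₀, by simpa using hi₀⟩ f hf
  have hL : ∀ r, MemLp (fun ω : Path V => b r * ω (f r).1 (f r).2) 2 P :=
    fun r => (h.square_integrable _ _).const_mul _
  set U : Path V → ℝ := fun ω => ∑ r, b r * ω (f r).1 (f r).2 with hU
  have hUL : MemLp U 2 P := memLp_finsetSum _ fun r _ => hL r
  have hvar : Var[U; P] = 0 := by
    rw [← covariance_self hUL.aemeasurable, hU, covariance_fun_sum_left hL hUL]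
    refine Finset.sum_eq_zero fun r _ => ?_
    rw [covariance_const_mul_left,
      covariance_fun_sum_right hL (h.square_integrable _ _)]
    have := congrFun hMb r
    simp only [Matrix.mulVec, dotProduct, Matrix.of_apply, Pi.zero_apply] at this
    simp only [covariance_const_mul_right]
    rw [Finset.sum_congr rfl fun s _ => mul_comm (b s) _, this, mul_zero]
  -- `U` is almost surely constant.
  have hcov : cov[U, noise γmax c (f i); P] = 0 := by
    refine integral_eq_zero_of_ae ?_
    filter_upwards [ae_eq_integral_of_variance_eq_zero hUL hvar] with ω hω
    simp [hω]
  rw [hU, covariance_fun_sum_left hL (h.memLp_noise _), Finset.sum_eq_single i,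
    covariance_const_mul_left, h.covariance_self_noise hG hW] at hcov
  · exact mul_ne_zero (by simpa using hi) (h.noise_nondegenerate _).ne' hcov
  · intro r _ hr
    rw [covariance_const_mul_left]
    by_cases hbr : b r = 0
    · simp [hbr]
    · rw [h.covariance_noise (hlast r (by simpa using hbr) hr), mul_zero]
  · simp

/-- The regressors of a direct effect on `Y` are all the values that `Y_t` may depend on. -/
theorem mem_insert_adjustmentSet [DecidableEq (V × ℕ)] {X Y : V} {γ : ℕ} (hXY : G X Y)
    (hγ : γ ≤ γmax) (hpos : X = Y → 0 < γ) (r : V × ℕ) :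
    r ∈ insert (X, γ) (adjustmentSet G γmax X Y γ) ↔
      G r.1 Y ∧ r.2 ≤ γmax ∧ r ≠ (Y, 0) := by
  obtain ⟨Z, k⟩ := r
  unfold adjustmentSet
  split_ifs with hY <;>
    simp only [Finset.mem_insert, Finset.mem_sdiff, Finset.mem_union, Finset.mem_product,
      Finset.mem_filter, Finset.mem_univ, true_and, Finset.mem_range, Finset.mem_singleton,
      Finset.mem_erase, Finset.mem_Icc, Finset.notMem_empty, Prod.mk.injEq, ne_eq] <;>
    grind

/-- The normal equations have the structural coefficients as their unique solution. -/
theorem IsLinearSCM.directEffect_eq (h : IsLinearSCM W c P) (hG : IsASCGL G)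
    (hW : W.HasSummary G) (t : ℤ) {X Y : V} {γ : ℕ} (hXY : G X Y)
    (hγ : γ ≤ γmax) (hpos : X = Y → 0 < γ) :
    directEffect G γmax P t X Y γ = c Y t X γ := by
  classical
  have hmem := mem_insert_adjustmentSet (γmax := γmax) hXY hγ hpos
  unfold directEffect
  extract_lets R val M v
  have hdet : IsUnit M.det := isUnit_iff_ne_zero.2 <|
    h.det_covariance_ne_zero hG hW (fun r : R => (r.1.1, t - (r.1.2 : ℤ))) <| by
      rintro ⟨⟨A, k⟩, _⟩ ⟨⟨B, l⟩, _⟩ hAB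
      simpa using hAB
  have hv : v = M.mulVec fun s : R => c Y t s.1.1 s.1.2 := by
    ext r
    have hr := (hmem r.1).1 (by convert r.2)
    change cov[val r, fun ω : Path V => ω Y t; P] = _
    rw [h.covariance_eq (h.square_integrable _ _),
      covariance_comm, covariance_comm,
      h.covariance_noise (j := (r.1.1, t - (r.1.2 : ℤ)))
        (W.notMem_ancestors_of_parent hG hW hr.1 hr.2.2 t), add_zero]
    refine Eq.trans ?_ (Finset.sum_coe_sort R fun s : V × ℕ =>
      cov[val r, fun ω : Path V => ω s.1 (t - (s.2 : ℤ)); P] * c Y t s.1 s.2).symm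
    symm
    refine (Finset.sum_subset (fun s hs => ?_) fun s _ hs => ?_).trans
      (Finset.sum_congr rfl fun s _ => mul_comm _ _)
    · have := (hmem s).1 (by convert hs)
      simp [this.2.1]
    · rw [mul_eq_zero]
      refine .inr (not_not.1 fun hc => hs ?_)
      have he := h.support _ _ _ _ hc
      have := (hmem s).2 ⟨(hW _ _).2 ⟨_, he⟩, W.lag_le _ _ _ he, by
        rintro rfl
        exact W.no_self _ he⟩
      convert this
  rw [hv, Matrix.mulVec_mulVec, Matrix.nonsing_inv_mul _ hdet, Matrix.one_mulVec]

end SCM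

/-! ### Minimality and nonzero coefficients -/

/-- If `Y = u(Z) + ε` with `ε` independent of `Z`, then the conditional law of `Y` given `Z = z` is
the law of `u(z) + ε`. -/
theorem condDistrib_ae_eq_of_eq_add {Ω α : Type*} [MeasurableSpace Ω] [MeasurableSpace α]
    {μ : Measure Ω} [IsProbabilityMeasure μ] {Y ε : Ω → ℝ} {Z : Ω → α} (hY : Measurable Y)
    (hε : Measurable ε) (hZ : Measurable Z) {u : α → ℝ} (hu : Measurable u)
    (hYeq : ∀ ω, Y ω = u (Z ω) + ε ω) (hind : IndepFun Z ε μ) :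
    condDistrib Y Z μ =ᵐ[μ.map Z]
      (Kernel.deterministic u hu ×ₖ Kernel.const α (μ.map ε)).map (fun p => p.1 + p.2) := by
  have := Measure.isProbabilityMeasure_map (μ := μ) hε.aemeasurable
  have hadd : Measurable fun p : ℝ × ℝ => p.1 + p.2 := by fun_prop
  refine condDistrib_ae_eq_of_measure_eq_compProd Z hY.aemeasurable ?_
  have hF : Measurable fun p : α × ℝ => (p.1, u p.1 + p.2) := by fun_prop
  have hcomp : (fun ω => (Z ω, Y ω)) = (fun p : α × ℝ => (p.1, u p.1 + p.2)) ∘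
      fun ω => (Z ω, ε ω) := by
    ext ω <;> simp [hYeq]
  rw [hcomp, ← Measure.map_map hF (hZ.prodMk hε),
    (indepFun_iff_map_prod_eq_prod_map_map hZ.aemeasurable hε.aemeasurable).1 hind]
  ext s hs
  rw [Measure.map_apply hF hs, Measure.prod_apply (hF hs), Measure.compProd_apply hs]
  refine lintegral_congr fun z => ?_
  have hs' : MeasurableSet (Prod.mk z ⁻¹' s) := measurable_prodMk_left hs
  rw [Kernel.map_apply' _ hadd _ hs', Kernel.prod_apply, Kernel.deterministic_apply,
    Kernel.const_apply, Measure.dirac_prod, Measure.map_apply measurable_prodMk_left (hadd hs')]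
  rfl

/-- If `Y = h(L) + ε` with `ε` independent of `(L, X)`, then `Y` and `X` are conditionally
independent given `L`: the conditional law of `Y` given `(L, X)` is the law of `h(L) + ε` with `L`
held fixed. -/
theorem condIndepFun_of_eq_add {Ω β : Type*} [MeasurableSpace Ω] [StandardBorelSpace Ω]
    [MeasurableSpace β] {μ : Measure Ω} [IsProbabilityMeasure μ] {Y X ε : Ω → ℝ} {K : Ω → β}
    (hY : Measurable Y) (hX : Measurable X) (hε : Measurable ε) (hK : Measurable K)
    {h : β → ℝ} (hh : Measurable h) (hYeq : ∀ ω, Y ω = h (K ω) + ε ω)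
    (hind : IndepFun (fun ω => (K ω, X ω)) ε μ) :
    CondIndepFun (MeasurableSpace.comap K inferInstance) hK.comap_le Y X μ := by
  refine CondIndepFun.symm ((condIndepFun_iff_condDistrib_prod_ae_eq_prodMkRight hY hX hK).2 ?_)
  have hind' : IndepFun K ε μ := hind.comp measurable_fst measurable_id
  have h₁ := condDistrib_ae_eq_of_eq_add hY hε (hK.prodMk hX) (u := fun p => h p.1) (by fun_prop)
    hYeq hind
  have h₂ := condDistrib_ae_eq_of_eq_add hY hε hK hh hYeq hind'
  have h₃ : ∀ᵐ p ∂μ.map fun ω => (K ω, X ω), condDistrib Y K μ p.1 =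
      (Kernel.deterministic h hh ×ₖ Kernel.const β (μ.map ε)).map (fun p => p.1 + p.2) p.1 := by
    have hmap : (μ.map fun ω => (K ω, X ω)).map Prod.fst = μ.map K :=
      Measure.map_map measurable_fst (hK.prodMk hX)
    rw [← hmap] at h₂
    exact ae_of_ae_map measurable_fst.aemeasurable h₂
  filter_upwards [h₁, h₃] with p hp₁ hp₃
  have := Measure.isProbabilityMeasure_map (μ := μ) hε.aemeasurable
  have hadd : Measurable fun p : ℝ × ℝ => p.1 + p.2 := by fun_prop
  rw [hp₁, Kernel.prodMkRight_apply, hp₃, Kernel.map_apply _ hadd, Kernel.map_apply _ hadd,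
    Kernel.prod_apply, Kernel.prod_apply]
  simp [Kernel.deterministic_apply]

section SCM

variable {V : Type*} [Fintype V] {γmax : ℕ} {W : WindowGraph V γmax}
  {c : V → ℤ → V → ℕ → ℝ} {P : Measure (Path V)} [IsProbabilityMeasure P] {G : V → V → Prop}

/-- Minimality excludes vanishing coefficients on the arcs: without the term of `X_{t-γ}`, the
equation of `Y_t` writes it as a function of its other parents plus a noise independent of them and
of `X_{t-γ}`. -/
theorem IsLinearSCM.coef_ne_zero {a : V → V → ℕ → ℝ} (h : IsLinearSCM W (fun Y _ => a Y) P)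
    (hG : IsASCGL G) (hW : W.HasSummary G) (hmin : Minimality W P) {X Y : V} {γ : ℕ}
    (he : W.edge X Y γ) : a Y X γ ≠ 0 := by
  classical
  intro ha
  obtain ⟨t, ht⟩ := hmin X Y γ he
  refine ht ?_
  set S : Set (V × ℕ) := {r : V × ℕ | W.edge r.1 Y r.2 ∧ r ≠ (X, γ)} with hS
  -- `none` stands for `X_{t-γ}`, and `some r` for the other parents.
  have hind := h.indepFun_noise (fun r : Option S => r.elim (X, t - (γ : ℤ))
    (fun r => (r.1.1, t - (r.1.2 : ℤ)))) (Y, t) (by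
      rintro (_ | r)
      · exact W.notMem_ancestors_of_fullArc hG hW ⟨γ, he, by simp⟩
      · exact W.notMem_ancestors_of_fullArc hG hW ⟨r.1.2, r.2.1, by simp⟩)
  refine condIndepFun_of_eq_add (ε := noise γmax (fun Y _ => a Y) (Y, t))
    (h := fun l => ∑ r ∈ Finset.univ ×ˢ Finset.range (γmax + 1),
      if hr : r ∈ S then a Y r.1 r.2 * l ⟨r, hr⟩ else 0)
    (by fun_prop) (by fun_prop) (measurable_noise _ _) (measurable_lagged S t) ?_ ?_ ?_
  · refine Finset.measurable_sum _ fun r _ => ?_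
    split_ifs <;> fun_prop
  · intro ω
    rw [congrFun (eq_sum_add_noise (γmax := γmax) (fun Y _ => a Y) Y t) ω]
    congr 1
    refine Finset.sum_congr rfl fun r _ => ?_
    split_ifs with hr
    · rfl
    · have : a Y r.1 r.2 = 0 := by
        by_contra hne
        have he' := h.support Y t r.1 r.2 hne
        refine hr ⟨he', ?_⟩
        rintro rfl
        exact hne ha
      simp [this]
  · exact hind.comp (φ := fun x => ((fun r : S => x (some r)), x none)) (ψ := id)
      (by fun_prop) measurable_id

end SCM

/-! ### Propagation of anomalies and linked anomalous graphs -/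

/-- Either the anomaly on `Y` originates from `Y` itself, or the last arc of its propagation, loops
aside, comes from an anomalous parent with an earlier or simultaneous anomaly. -/
theorem PropagatedFrom.eq_or_exists_parent {V : Type*} {γmax : ℕ} {W : WindowGraph V γmax}
    {G : V → V → Prop} (hW : W.HasSummary G) {A : Set V} {τ : V → ℤ} {X Y : V}
    (h : PropagatedFrom W A τ X Y) :
    X = Y ∨ ∃ Z ∈ A, Z ≠ Y ∧ G Z Y ∧ τ Z ≤ τ Y := by
  have mem : ∀ {Y}, PropagatedFrom W A τ X Y → Y ∈ A := by
    intro Y h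
    cases h <;> assumption
  induction h with
  | refl _ => exact .inl rfl
  | @step Y Z γ hY _ he hτ ih =>
    by_cases hYZ : Y = Z
    · exact hYZ ▸ ih
    · exact .inr ⟨Y, mem hY, hYZ, (hW _ _).2 ⟨γ, he⟩, by omega⟩

theorem PropagatedFrom.mem_left {V : Type*} {γmax : ℕ} {W : WindowGraph V γmax} {A : Set V}
    {τ : V → ℤ} {X Y : V} (h : PropagatedFrom W A τ X Y) : X ∈ A := by
  induction h with
  | refl h => exact h
  | step _ _ _ _ ih => exact ih

/-- A path with two vertices cannot be blocked. -/
theorem IsLinkedAnomalousList.mem_of_adj {V : Type*} {G : V → V → Prop} {A : Set V}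
    {L : List (Set V)} (hL : IsLinkedAnomalousList G A L) {B : Set V} (hB : B ∈ L) {Y Z : V}
    (hY : Y ∈ B) (hZ : Z ∈ A) (hne : Z ≠ Y) (hadj : G Z Y) : Z ∈ B := by
  by_contra hZB
  obtain ⟨S, _, hS⟩ := hL.dsep B hB
  obtain ⟨_, _, _, hinf, _⟩ := hS [Y, Z] ⟨by simpa using hne.symm, by simp [hadj]⟩
    ⟨Y, hY, rfl⟩ ⟨Z, ⟨hZ, hZB⟩, rfl⟩
  simpa using hinf.length_le

theorem mem_rootCauses_of_no_earlier_parent {V : Type*} {γmax : ℕ} {W : WindowGraph V γmax}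
    {G : V → V → Prop} (hW : W.HasSummary G) {A : Set V} {τ : V → ℤ} {active : V → Set ℤ}
    (hprop : AnomalyPropagation W A τ active) {L : List (Set V)}
    (hL : IsLinkedAnomalousList G A L) {B : Set V} (hB : B ∈ L) {Y : V} (hY : Y ∈ B)
    (hno : ∀ Z ∈ B, Z ≠ Y → G Z Y → τ Y < τ Z) : Y ∈ rootCauses W A τ active := by
  have hYA := hL.subset B hB hY
  obtain ⟨X, hX, hXY⟩ := hprop.origin Y hYA
  rcases hXY.eq_or_exists_parent hW with rfl | ⟨Z, hZ, hne, hZY, hτ⟩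
  · exact ⟨hX, X, hYA, .refl hYA⟩
  · exact absurd (hno Z (hL.mem_of_adj hB hY hZ hne hZY) hne hZY) (not_lt.2 hτ)

end EasyRCA

theorem mainTheorem1 {V : Type*} [Fintype V] (G : V → V → Prop) (hG : EasyRCA.IsASCGL G)
    (γmax : ℕ) (W : EasyRCA.WindowGraph V γmax) (hW : W.HasSummary G)
    (P P' : MeasureTheory.Measure (EasyRCA.Path V))
    [MeasureTheory.IsProbabilityMeasure P] [MeasureTheory.IsProbabilityMeasure P']
    (a a' : V → V → ℕ → ℝ) (active : V → Set ℤ)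
    (hsys : EasyRCA.IsIntervenedSystem W G a a' active P P')
    (hmin : EasyRCA.Minimality W P)
    (A : Set V) (hA : A = EasyRCA.anomalousVertices P P')
    (τ : V → ℤ) (hτ : ∀ Y ∈ A, IsLeast {t : ℤ | EasyRCA.AnomalyAt P P' Y t} (τ Y))
    (hprop : EasyRCA.AnomalyPropagation W A τ active)
    (L : List (Set V)) (hL : EasyRCA.IsLinkedAnomalousList G A L)
    (t t' : ℤ) (ht' : t' ∈ EasyRCA.anomalousRegime active) :
    (EasyRCA.easyRCA G γmax A τ P P' t t' L).R ∪ (EasyRCA.easyRCA G γmax A τ P P' t t' L).T ∪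
      (EasyRCA.easyRCA G γmax A τ P P' t t' L).D = EasyRCA.rootCauses W A τ active := by
  ext Y
  simp only [EasyRCA.easyRCA, Set.mem_union, Set.mem_iUnion, exists_prop]
  constructor
  · rintro ((⟨B, hB, hY, hno⟩ | ⟨B, hB, hY, hno⟩) | ⟨B, hB, ⟨hY, -⟩, X, hXY, γ, hγ, -, hne⟩)
    · exact EasyRCA.mem_rootCauses_of_no_earlier_parent hW hprop hL hB hY
        fun Z hZ hZY hadj => absurd hadj (hno Z hZ hZY)
    · exact EasyRCA.mem_rootCauses_of_no_earlier_parent hW hprop hL hB hY hno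
    · have hYA := hL.subset B hB hY
      refine ⟨?_, Y, hYA, .refl hYA⟩
      by_contra hact
      rw [Set.not_nonempty_iff_eq_empty] at hact
      refine hne ?_
      rw [hsys.normal.directEffect_eq hG hW t hXY hγ.2.1 hγ.2.2,
        hsys.intervened.directEffect_eq hG hW t' hXY hγ.2.1 hγ.2.2]
      simp [EasyRCA.regimeCoef, hact]
  · rintro ⟨hact, Z, -, hYZ⟩
    have hYA := hYZ.mem_left
    obtain ⟨B, hB, hYB⟩ := hL.cover Y hYA
    by_cases hR : Y ∈ EasyRCA.subRoots G B
    · exact .inl (.inl ⟨B, hB, hR⟩)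
    by_cases hT : Y ∈ EasyRCA.timeDefying G τ B
    · exact .inl (.inr ⟨B, hB, hT⟩)
    have hpar : ∃ X, X ≠ Y ∧ G X Y := by
      by_contra! hcon
      exact hR ⟨hYB, fun X _ hne => hcon X hne⟩
    -- The intervention changes the coefficient of an arc: a changed coefficient cannot vanish in
    -- both regimes, so it belongs to an arc.
    obtain ⟨X, γ, he, hne⟩ : ∃ X γ, W.edge X Y γ ∧ a Y X γ ≠ a' Y X γ := by
      rcases hsys.kind Y hact hpar with ⟨hne, -⟩ | ⟨X, hXY, hzero⟩
      · obtain ⟨X, hX⟩ := Function.ne_iff.1 hne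
        obtain ⟨γ, hγ⟩ := Function.ne_iff.1 hX
        refine ⟨X, γ, ?_, hγ.symm⟩
        by_cases h0 : a Y X γ = 0
        · refine hsys.intervened.support Y t' X γ ?_
          rw [h0] at hγ
          simpa [EasyRCA.regimeCoef, ht' Y hact] using hγ
        · exact hsys.normal.support Y t X γ h0
      · obtain ⟨γ, he⟩ := (hW X Y).1 hXY
        exact ⟨X, γ, he, by
          rw [hzero γ]
          exact hsys.normal.coef_ne_zero hG hW hmin he⟩
    have hXY : G X Y := (hW X Y).2 ⟨γ, he⟩
    have hγ := W.lag_le X Y γ he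
    have hpos : X = Y → 0 < γ := by
      rintro rfl
      exact Nat.pos_of_ne_zero fun h0 => W.no_self X (h0 ▸ he)
    refine .inr ⟨B, hB, ⟨hYB, fun h => h.elim hR hT⟩, X, hXY, γ, ⟨?_, hγ, hpos⟩, ?_⟩
    · unfold EasyRCA.anomalyLag
      split_ifs with hXA
      · have := hprop.lag X hXA Y hYA γ he
        omega
      · positivity
    · rw [hsys.normal.directEffect_eq hG hW t hXY hγ hpos,
        hsys.intervened.directEffect_eq hG hW t' hXY hγ hpos]
      refine ⟨hsys.normal.coef_ne_zero hG hW hmin he, ?_⟩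
      simpa [EasyRCA.regimeCoef, ht' Y hact] using hne
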